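/- Let $\mathbb{R}^{+}=(0,\infty)$ and let $L^2(\mathbb{R}^{+})$ be the Hilbert space of complex-valued square integrable functions on $\mathbb{R}^{+}$ with respect to Lebesgue measure. Let $\mathfrak{M}=L^2(\mathbb{R}^{+})\oplus L^2(\mathbb{R}^{+})$ be the orthogonal sum, whose elements are columns $\varphi=\begin{bmatrix}\varphi_{+}\\ \varphi_{-}\end{bmatrix}$. The truncated Fourier–Plancherel operator $\mathscr{F}_{\mathbb{R}^{+}}:L^2(\mathbb{R}^{+})\to L^2(\mathbb{R}^{+})$ is the extension by continuity, from the dense subspace $L^1(\mathbb{R}^{+})\cap L^2(\mathbb{R}^{+})$, of $$(\mathscr{F}_{\mathbb{R}^{+}}x)(t)=\frac{1}{\sqrt{2\pi}}\int_{\mathbb{R}^{+}}x(\xi)e^{it\xi}\,d\xi,\qquad t\in\mathbb{R}^{+}.$$ Let $\mathcal{D}$ be the dense subspace of all $x\in L^2(\mathbb{R}^{+})$ with $\int_{\mathbb{R}^{+}}|x(\xi)|\,\xi^{-1/2}\,d\xi<\infty$, and let $U:L^2(\mathbb{R}^{+})\to\mathfrak{M}$ be the extension by continuity, from $\mathcal{D}$,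 of the map $x\mapsto\begin{bmatrix}(Ux)_{+}\\ (Ux)_{-}\end{bmatrix}$, $$(Ux)_{\pm}(\mu)=\frac{1}{\sqrt{2\pi}}\int_{\mathbb{R}^{+}}x(\xi)\,\xi^{-1/2}\xi^{\pm i\mu}\,d\xi,\qquad \mu\in\mathbb{R}^{+}$$ (the Mellin transform on the line $\operatorname{Re}\zeta=\tfrac12$, split into two half-lines). For $\mu\in\mathbb{R}^{+}$ put $$F(\mu)=\begin{bmatrix}0&F_{+-}(\mu)\\ F_{-+}(\mu)&0\end{bmatrix},\qquad F_{+-}(\mu)=\frac{e^{i\pi/4}}{\sqrt{2\pi}}\,e^{-\pi\mu/2}\,\Gamma\big(\tfrac12+i\mu\big),\qquad F_{-+}(\mu)=\frac{e^{i\pi/4}}{\sqrt{2\pi}}\,e^{\pi\mu/2}\,\Gamma\big(\tfrac12-i\mu\big).$$ Then $U$ is a unitary operator from $L^2(\mathbb{R}^{+})$ onto $\mathfrak{M}$; the multiplication operator $(\mathcal{M}_F\varphi)(\mu)=F(\mu)\varphi(\mu)$ is a bounded operator on all of $\mathfrak{M}$; and $\mathscr{F}_{\mathbb{R}^{+}}$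 is unitarily equivalent to $\mathcal{M}_F$ by means of $U$: $$\mathscr{F}_{\mathbb{R}^{+}}=U^{-1}\mathcal{M}_F\,U .$$ Equivalently, for every $x\in L^2(\mathbb{R}^{+})$, $(U\mathscr{F}_{\mathbb{R}^{+}}x)(\mu)=F(\mu)\,(Ux)(\mu)$ for almost every $\mu\in\mathbb{R}^{+}$. -/

import Mathlib

noncomputable section

namespace TruncFourier

open MeasureTheory Set

/-- The complex Hilbert space `L²(ℝ⁺)`, `ℝ⁺ = (0, ∞)` with Lebesgue measure. -/
abbrev L2Pos : Type := Lp ℂ 2 (volume.restrict (Ioi (0 : ℝ)))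

/-- The model space: the orthogonal sum `L²(ℝ⁺) ⊕ L²(ℝ⁺)`, whose elements are the columns
`(φ₊, φ₋) = (φ.fst, φ.snd)`. -/
abbrev ModelSpace : Type := WithLp 2 (L2Pos × L2Pos)

/-! ### Auxiliary facts: the Fourier integral of a function of `L¹ ∩ L²` is in `L²` -/

open FourierTransform SchwartzMap ContDiff in
theorem memLp_fourier {f : ℝ → ℂ} (h1 : Integrable f) (h2 : MemLp f 2) : MemLp (𝓕 f) 2 := by
  have hc : Continuous (𝓕 f) :=
    VectorFourier.fourierIntegral_continuous Real.continuous_fourierChar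
      (by exact continuous_inner) h1
  have key : ∀ᵐ t, 𝓕 f t = (𝓕 (h2.toLp f) : Lp ℂ 2 (volume : Measure ℝ)) t := by
    refine ae_eq_of_integral_contDiff_smul_eq hc.locallyIntegrable
      ((Lp.memLp _).locallyIntegrable (by norm_num)) fun g g_smooth g_cpt => ?_
    have hg₁ : HasCompactSupport (Complex.ofRealCLM ∘ g) := g_cpt.comp_left rfl
    have hg₂ : ContDiff ℝ ∞ (Complex.ofRealCLM ∘ g) := by fun_prop
    have e1 : ((𝓕 (h2.toLp f) : Lp ℂ 2 (volume : Measure ℝ)) : 𝓢'(ℝ, ℂ))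
        (hg₁.toSchwartzMap hg₂) = ((h2.toLp f : Lp ℂ 2 (volume : Measure ℝ)) : 𝓢'(ℝ, ℂ))
          (𝓕 (hg₁.toSchwartzMap hg₂)) := by
      rw [← Lp.fourier_toTemperedDistribution_eq, TemperedDistribution.fourier_apply]
    rw [Lp.toTemperedDistribution_apply, Lp.toTemperedDistribution_apply] at e1
    have e2 : ∫ t, (𝓕 (hg₁.toSchwartzMap hg₂)) t • (h2.toLp f) t
        = ∫ t, (𝓕 (hg₁.toSchwartzMap hg₂)) t • f t := by
      apply integral_congr_ae
      filter_upwards [h2.coeFn_toLp] with t ht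
      rw [ht]
    have e3 : ∫ t, (𝓕 (hg₁.toSchwartzMap hg₂)) t • f t
        = ∫ t, (hg₁.toSchwartzMap hg₂) t • 𝓕 f t := by
      have := VectorFourier.integral_fourierIntegral_smul_eq_flip (L := innerₗ ℝ)
        (μ := volume) (ν := volume) Real.continuous_fourierChar continuous_inner
        (hg₁.toSchwartzMap hg₂).integrable h1
      rw [flip_innerₗ] at this
      exact this
    rw [e2, e3] at e1
    simpa using e1.symm
  exact (Lp.memLp _).ae_eq (key.mono fun _ h => h.symm)

theorem memLp_comp_mul {g : ℝ → ℂ} (hg : MemLp g 2) {c : ℝ} (hc : c ≠ 0) :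
    MemLp (fun t => g (c * t)) 2 := by
  have hm : Measure.map (fun t : ℝ => c * t) volume = ENNReal.ofReal |c⁻¹| • volume :=
    Real.map_volume_mul_left hc
  have h := hg.smul_measure (c := ENNReal.ofReal |c⁻¹|) ENNReal.ofReal_ne_top
  rw [← hm] at h
  exact h.comp_of_map (by fun_prop)

/-! ### The truncated Fourier–Plancherel operator -/

/-- `(2π)^{-1/2} ∫_{ℝ⁺} x(ξ) e^{itξ} dξ`. -/
def fourierIntegralPos (x : ℝ → ℂ) (t : ℝ) : ℂ :=
  ((1 / √(2 * Real.pi) : ℝ) : ℂ) *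
    ∫ ξ in Ioi (0 : ℝ), x ξ * Complex.exp (Complex.I * t * ξ)

/-- The dense subspace `L¹(ℝ⁺) ∩ L²(ℝ⁺)` of `L²(ℝ⁺)`, on which the Fourier integral converges
absolutely. -/
def fourierDomain : Submodule ℂ L2Pos where
  carrier := {x | Integrable (fun ξ => x ξ) (volume.restrict (Ioi (0 : ℝ)))}
  zero_mem' := by
    refine Integrable.congr (f := fun _ : ℝ => (0 : ℂ)) (integrable_zero _ _ _) ?_
    exact (Lp.coeFn_zero ℂ 2 (volume.restrict (Ioi (0 : ℝ)))).symm
  add_mem' {x y} hx hy := by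
    refine Integrable.congr (Integrable.add hx hy) ?_
    exact (Lp.coeFn_add x y).symm
  smul_mem' c x hx := by
    refine Integrable.congr (Integrable.smul c hx) ?_
    exact (Lp.coeFn_smul c x).symm

theorem integrableOn_mul_exp {x : ℝ → ℂ} (h1 : IntegrableOn x (Ioi 0)) (t : ℝ) :
    IntegrableOn (fun ξ : ℝ => x ξ * Complex.exp (Complex.I * t * ξ)) (Ioi 0) := by
  refine Integrable.mul_bdd (c := 1) h1 (by fun_prop) (Filter.Eventually.of_forall fun ξ => ?_)
  rw [show Complex.I * t * ξ = ((t * ξ : ℝ) : ℂ) * Complex.I by push_cast; ring,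
    Complex.norm_exp_ofReal_mul_I]

theorem fourierIntegralPos_eq (x : ℝ → ℂ) (t : ℝ) :
    fourierIntegralPos x t = ((1 / √(2 * Real.pi) : ℝ) : ℂ) *
      FourierTransform.fourier ((Ioi (0 : ℝ)).indicator x) (-(2 * Real.pi)⁻¹ * t) := by
  rw [fourierIntegralPos, Real.fourier_eq', ← integral_indicator measurableSet_Ioi]
  congr 2
  ext ξ
  by_cases hξ : ξ ∈ Ioi (0 : ℝ)
  · simp only [indicator_of_mem hξ, smul_eq_mul]
    rw [mul_comm]
    congr 2
    have := Real.pi_ne_zero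
    simp only [RCLike.inner_apply, conj_trivial]
    push_cast
    have : (Real.pi : ℂ) ≠ 0 := by exact_mod_cast this
    field_simp
  · simp [indicator_of_notMem hξ]

theorem memLp_fourierIntegralPos {x : ℝ → ℂ} (h1 : IntegrableOn x (Ioi 0))
    (h2 : MemLp x 2 (volume.restrict (Ioi 0))) :
    MemLp (fourierIntegralPos x) 2 (volume.restrict (Ioi 0)) := by
  have h := memLp_comp_mul (c := -(2 * Real.pi)⁻¹)
    (memLp_fourier ((integrable_indicator_iff measurableSet_Ioi).2 h1)
      ((memLp_indicator_iff_restrict measurableSet_Ioi).2 h2)) (by simp [Real.pi_ne_zero])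
  rw [show fourierIntegralPos x = _ from funext (fourierIntegralPos_eq x)]
  exact (h.restrict (Ioi 0)).const_mul _

/-- The Fourier integral as a linear map on `L¹(ℝ⁺) ∩ L²(ℝ⁺)` with values in `L²(ℝ⁺)`. -/
def fourierOnDomain : fourierDomain →ₗ[ℂ] L2Pos where
  toFun x := (memLp_fourierIntegralPos x.2 (Lp.memLp x.1)).toLp
  map_add' x y := by
    rw [← MemLp.toLp_add]
    congr 1
    ext t
    simp only [Pi.add_apply, fourierIntegralPos]
    rw [← mul_add, ← integral_add (integrableOn_mul_exp x.2 t) (integrableOn_mul_exp y.2 t)]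
    congr 1
    apply integral_congr_ae
    filter_upwards [Lp.coeFn_add x.1 y.1] with ξ hξ
    rw [Submodule.coe_add, hξ, Pi.add_apply, add_mul]
  map_smul' c x := by
    rw [RingHom.id_apply, ← MemLp.toLp_const_smul]
    congr 1
    ext t
    simp only [Pi.smul_apply, fourierIntegralPos, smul_eq_mul]
    rw [mul_left_comm, ← integral_const_mul c]
    congr 1
    apply integral_congr_ae
    filter_upwards [Lp.coeFn_smul c x.1] with ξ hξ
    rw [Submodule.coe_smul, hξ, Pi.smul_apply, smul_eq_mul, mul_assoc]

/-- The truncated Fourier–Plancherel operator on `L²(ℝ⁺)`: the extension by continuity of the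
Fourier integral from `L¹(ℝ⁺) ∩ L²(ℝ⁺)` to `L²(ℝ⁺)`. -/
def truncatedFourier : L2Pos →L[ℂ] L2Pos :=
  fourierOnDomain.extendOfNorm fourierDomain.subtype

/-! ### The operator `U` -/

/-- The subspace `𝒟` of all `x ∈ L²(ℝ⁺)` with `∫_{ℝ⁺} |x(ξ)| ξ^{-1/2} dξ < ∞`. -/
def mellinDomain : Submodule ℂ L2Pos where
  carrier := {x | IntegrableOn (fun ξ : ℝ => ‖x ξ‖ * ξ ^ (-(1 / 2) : ℝ)) (Ioi 0)}
  zero_mem' := by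
    refine (integrable_zero ℝ ℝ _).congr ?_
    filter_upwards [Lp.coeFn_zero ℂ 2 (volume.restrict (Ioi (0 : ℝ)))] with ξ hξ
    have h : (0 : L2Pos) ξ = 0 := hξ
    change (0 : ℝ) = ‖(0 : L2Pos) ξ‖ * _
    rw [h, norm_zero, zero_mul]
  add_mem' {x y} hx hy := by
    refine Integrable.mono' (hx.add hy) ?_ ?_
    · exact (Lp.aestronglyMeasurable _).norm.mul
        (by fun_prop : Measurable fun ξ : ℝ => ξ ^ (-(1 / 2) : ℝ)).aestronglyMeasurable
    · filter_upwards [Lp.coeFn_add x y, ae_restrict_mem measurableSet_Ioi] with ξ hξ h0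
      have h0' : 0 ≤ ξ ^ (-(1 / 2) : ℝ) := Real.rpow_nonneg (le_of_lt h0) _
      rw [hξ, Pi.add_apply, Pi.add_apply, norm_mul, norm_norm, Real.norm_of_nonneg h0', ← add_mul]
      exact mul_le_mul_of_nonneg_right (norm_add_le _ _) h0'
  smul_mem' c x hx := by
    refine (Integrable.const_mul hx ‖c‖).congr ?_
    filter_upwards [Lp.coeFn_smul c x] with ξ hξ
    rw [hξ, Pi.smul_apply, norm_smul, mul_assoc]

/-- `(2π)^{-1/2} ∫_{ℝ⁺} x(ξ) ξ^{-1/2} ξ^{iν} dξ` for real `ν`, that is, up to the constant, the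
Mellin transform of `x` at the point `1/2 + iν`. -/
def mellinIntegral (x : ℝ → ℂ) (ν : ℝ) : ℂ :=
  ((1 / √(2 * Real.pi) : ℝ) : ℂ) *
    ∫ ξ in Ioi (0 : ℝ), x ξ * (ξ : ℂ) ^ (-(1 / 2) : ℂ) * (ξ : ℂ) ^ (Complex.I * ν)

theorem integrableOn_mul_cpow {x : L2Pos} (hx : x ∈ mellinDomain) (ν : ℝ) :
    IntegrableOn (fun ξ : ℝ => x ξ * (ξ : ℂ) ^ (-(1 / 2) : ℂ) * (ξ : ℂ) ^ (Complex.I * ν))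
      (Ioi 0) := by
  refine Integrable.mono' hx ?_ ?_
  · exact ((Lp.aestronglyMeasurable _).mul
      (by fun_prop : Measurable fun ξ : ℝ => (ξ : ℂ) ^ (-(1 / 2) : ℂ)).aestronglyMeasurable).mul
      (by fun_prop : Measurable fun ξ : ℝ => (ξ : ℂ) ^ (Complex.I * ν)).aestronglyMeasurable
  · filter_upwards [ae_restrict_mem measurableSet_Ioi] with ξ h0
    rw [norm_mul, norm_mul, Complex.norm_cpow_eq_rpow_re_of_pos h0,
      Complex.norm_cpow_eq_rpow_re_of_pos h0]
    simp

theorem mellinIntegral_eq (x : ℝ → ℂ) (ν : ℝ) :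
    mellinIntegral x ν = ((1 / √(2 * Real.pi) : ℝ) : ℂ) *
      FourierTransform.fourier (fun u : ℝ => Real.exp (-(1 / 2) * u) • x (Real.exp (-u)))
        ((2 * Real.pi)⁻¹ * ν) := by
  have h := mellin_eq_fourier x (s := 1 / 2 + Complex.I * ν)
  have e1 : (1 / 2 + Complex.I * ν : ℂ).re = 1 / 2 := by simp
  have e2 : (1 / 2 + Complex.I * ν : ℂ).im = ν := by simp
  rw [e1, e2] at h
  rw [mul_comm (2 * Real.pi)⁻¹, ← div_eq_mul_inv, ← h, mellinIntegral, mellin]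
  congr 1
  refine setIntegral_congr_fun measurableSet_Ioi fun ξ hξ => ?_
  have h0 : (ξ : ℂ) ≠ 0 := by exact_mod_cast (ne_of_gt hξ)
  simp only [smul_eq_mul]
  rw [mul_assoc, ← Complex.cpow_add _ _ h0, mul_comm]
  congr 2
  ring

theorem exp_neg_image : (fun u : ℝ => Real.exp (-u)) '' univ = Ioi 0 := by
  rw [image_univ]
  ext y
  refine ⟨?_, fun hy => ⟨-Real.log y, by simp [Real.exp_log hy]⟩⟩
  rintro ⟨u, rfl⟩
  exact Real.exp_pos _

theorem integrable_comp_exp_neg {F : Type*} [NormedAddCommGroup F] [NormedSpace ℝ F] {g : ℝ → F}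
    (hg : IntegrableOn g (Ioi 0)) : Integrable fun u : ℝ => Real.exp (-u) • g (Real.exp (-u)) := by
  have hd : ∀ u ∈ univ, HasDerivWithinAt (fun u : ℝ => Real.exp (-u)) (-Real.exp (-u)) univ u := by
    intro u _
    have h := ((Real.hasDerivAt_exp (-u)).comp u (hasDerivAt_neg u)).hasDerivWithinAt (s := univ)
    rwa [mul_neg_one] at h
  rw [← exp_neg_image, integrableOn_image_iff_integrableOn_abs_deriv_smul MeasurableSet.univ hd
    (fun a _ b _ h => by simpa using h)] at hg
  simpa [abs_of_pos (Real.exp_pos _)] using hg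

theorem memLp_mellinIntegral {x : L2Pos} (hx : x ∈ mellinDomain) {c : ℝ} (hc : c ≠ 0) :
    MemLp (fun μ => mellinIntegral x (c * μ)) 2 (volume.restrict (Ioi 0)) := by
  have hv1 : Integrable fun u : ℝ => Real.exp (-(1 / 2) * u) • x (Real.exp (-u)) := by
    have h := integrable_comp_exp_neg (integrableOn_mul_cpow hx 0)
    refine h.congr (Filter.Eventually.of_forall fun u => ?_)
    have h0 : 0 < Real.exp (-u) := Real.exp_pos _
    have e : ((Real.exp (-u) : ℝ) : ℂ) ^ (-(1 / 2) : ℂ) = ((Real.exp (u / 2) : ℝ) : ℂ) := by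
      rw [show (-(1 / 2) : ℂ) = ((-(1 / 2) : ℝ) : ℂ) by push_cast; ring,
        ← Complex.ofReal_cpow h0.le, ← Real.exp_mul]
      congr 2
      ring
    simp only [e, Complex.ofReal_zero, mul_zero, Complex.cpow_zero, mul_one, Complex.real_smul]
    rw [mul_comm (x _), ← mul_assoc, ← Complex.ofReal_mul, ← Real.exp_add]
    congr 3
    ring
  have hv2 : MemLp (fun u : ℝ => Real.exp (-(1 / 2) * u) • x (Real.exp (-u))) 2 := by
    rw [memLp_two_iff_integrable_sq_norm hv1.aestronglyMeasurable]
    have h := (memLp_two_iff_integrable_sq_norm (Lp.aestronglyMeasurable x)).1 (Lp.memLp x)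
    refine (integrable_comp_exp_neg h).congr (Filter.Eventually.of_forall fun u => ?_)
    simp only [norm_smul, mul_pow, smul_eq_mul, Real.norm_eq_abs, Real.abs_exp]
    rw [← Real.exp_nat_mul]
    congr 2
    push_cast
    ring
  have h := memLp_comp_mul (c := (2 * Real.pi)⁻¹ * c) (memLp_fourier hv1 hv2)
    (by simp [Real.pi_ne_zero, hc])
  simp only [mellinIntegral_eq, ← mul_assoc (2 * Real.pi)⁻¹ c]
  exact (h.restrict (Ioi 0)).const_mul _

theorem mellinIntegral_add {x y : L2Pos} (hx : x ∈ mellinDomain) (hy : y ∈ mellinDomain) (ν : ℝ) :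
    mellinIntegral (x + y : L2Pos) ν = mellinIntegral x ν + mellinIntegral y ν := by
  simp only [mellinIntegral]
  rw [← mul_add, ← integral_add (integrableOn_mul_cpow hx ν) (integrableOn_mul_cpow hy ν)]
  congr 1
  apply integral_congr_ae
  filter_upwards [Lp.coeFn_add x y] with ξ hξ
  rw [hξ, Pi.add_apply, add_mul, add_mul]

theorem mellinIntegral_smul (c : ℂ) (x : L2Pos) (ν : ℝ) :
    mellinIntegral (c • x : L2Pos) ν = c * mellinIntegral x ν := by
  simp only [mellinIntegral]
  rw [mul_left_comm, ← integral_const_mul c]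
  congr 1
  apply integral_congr_ae
  filter_upwards [Lp.coeFn_smul c x] with ξ hξ
  rw [hξ, Pi.smul_apply, smul_eq_mul, mul_assoc, mul_assoc, mul_assoc]

/-- `x ↦ (μ ↦ mellinIntegral x (c * μ))` as a linear map from `𝒟` to `L²(ℝ⁺)`. -/
def mellinBranch (c : ℝ) (hc : c ≠ 0) : mellinDomain →ₗ[ℂ] L2Pos where
  toFun x := (memLp_mellinIntegral x.2 hc).toLp
  map_add' x y := by
    rw [← MemLp.toLp_add]
    congr 1
    ext μ
    exact mellinIntegral_add x.2 y.2 _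
  map_smul' a x := by
    rw [RingHom.id_apply, ← MemLp.toLp_const_smul]
    congr 1
    ext μ
    exact mellinIntegral_smul a x.1 _

/-- The operator `U` on `𝒟`: `x ↦ ((Ux)₊, (Ux)₋)`, with
`(Ux)_±(μ) = (2π)^{-1/2} ∫_{ℝ⁺} x(ξ) ξ^{-1/2} ξ^{± iμ} dξ` for `μ ∈ ℝ⁺`. -/
def mellinOnDomain : mellinDomain →ₗ[ℂ] ModelSpace :=
  (WithLp.linearEquiv 2 ℂ (L2Pos × L2Pos)).symm.toLinearMap ∘ₗ
    (mellinBranch 1 one_ne_zero).prod (mellinBranch (-1) (neg_ne_zero.2 one_ne_zero))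

/-- The operator `U : L²(ℝ⁺) → L²(ℝ⁺) ⊕ L²(ℝ⁺)`, extended by continuity from `𝒟`. -/
def mellinU : L2Pos →L[ℂ] ModelSpace :=
  mellinOnDomain.extendOfNorm mellinDomain.subtype

/-! ### The model operator -/

/-- The value `φ(μ) = (φ₊(μ), φ₋(μ))` of a column of the model space. -/
def ModelSpace.column (φ : ModelSpace) (μ : ℝ) : Fin 2 → ℂ := ![φ.fst μ, φ.snd μ]

/-- The bounded operator `A` on the model space is the operator of multiplication by the matrix
function `M` on `ℝ⁺`: `(Aφ)(μ) = M(μ) φ(μ)` for almost every `μ ∈ ℝ⁺`, for every `φ`. -/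
def IsMultiplicationBy (M : ℝ → Matrix (Fin 2) (Fin 2) ℂ) (A : ModelSpace →L[ℂ] ModelSpace) :
    Prop :=
  ∀ φ : ModelSpace, ∀ᵐ μ ∂(volume.restrict (Ioi (0 : ℝ))),
    ModelSpace.column (A φ) μ = (M μ).mulVec (ModelSpace.column φ μ)

/-- `F₊₋(μ) = (2π)^{-1/2} e^{iπ/4} e^{-πμ/2} Γ(1/2 + iμ)`. -/
def symbolPM (μ : ℝ) : ℂ :=
  ((1 / √(2 * Real.pi) : ℝ) : ℂ) * Complex.exp (Complex.I * Real.pi / 4) *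
    Real.exp (-(Real.pi / 2) * μ) * Complex.Gamma (1 / 2 + Complex.I * μ)

/-- `F₋₊(μ) = (2π)^{-1/2} e^{iπ/4} e^{πμ/2} Γ(1/2 - iμ)`. -/
def symbolMP (μ : ℝ) : ℂ :=
  ((1 / √(2 * Real.pi) : ℝ) : ℂ) * Complex.exp (Complex.I * Real.pi / 4) *
    Real.exp (Real.pi / 2 * μ) * Complex.Gamma (1 / 2 - Complex.I * μ)

/-- The anti-diagonal matrix function `F(μ)`. -/
def symbolMatrix (μ : ℝ) : Matrix (Fin 2) (Fin 2) ℂ :=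
  !![0, symbolPM μ; symbolMP μ, 0]

end TruncFourier

end

/-! Substituting `ξ = e^{-u}` turns the Mellin integral on `Re ζ = 1/2` into a Fourier integral of
`e^{-u/2} x(e^{-u})`, and `x ↦ e^{-u/2} x(e^{-u})` preserves the `L²` norm. Plancherel then makes
`U` isometric (`norm_mellinOnDomain`), and Fourier inversion puts all smooth compactly supported
functions in the range of the Mellin integral (`exists_mellinIntegral_eq`), so `U` is onto.

The kernel `e^{itξ}` depends only on the product `tξ`, so the Mellin transform turns the Fourier
integral into multiplication by a scalar function composed with the reflection `ν ↦ -ν` of the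
critical line. The reflection exchanges the two half-lines, which is why `F` is anti-diagonal. The
scalar is the Mellin transform of `e^{it}` up to normalization, namely `e^{iπs/2} Γ(s)` with `s =
1/2 + iν`; that integral is only conditionally convergent, so it is reached by Abel summation
(`mellinIntegral_fourierIntegralPos`).

The reflection formula for `Γ` bounds the symbol by 1 (`norm_symbolPM_le`), so both sides of the
intertwining relation are bounded operators, and it suffices to check the relation on smooth
functions with compact support in `ℝ⁺`, where all transforms are honest integrals. -/

noncomputable section

namespace TruncFourier

open MeasureTheory Set

/-! ### Plancherel's identity for the Fourier integral on `L¹ ∩ L²` -/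

open FourierTransform SchwartzMap ContDiff in
/-- On `L¹ ∩ L²` the Fourier integral agrees with the `L²` Fourier transform. -/
theorem fourier_ae_eq_fourier_toLp {f : ℝ → ℂ} (h1 : Integrable f) (h2 : MemLp f 2) :
    𝓕 f =ᵐ[volume] (𝓕 (h2.toLp f) : Lp ℂ 2 (volume : Measure ℝ)) := by
  have hc : Continuous (𝓕 f) :=
    VectorFourier.fourierIntegral_continuous Real.continuous_fourierChar
      (by exact continuous_inner) h1
  refine ae_eq_of_integral_contDiff_smul_eq hc.locallyIntegrable
    ((Lp.memLp _).locallyIntegrable (by norm_num)) fun g g_smooth g_cpt => ?_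
  have hg₁ : HasCompactSupport (Complex.ofRealCLM ∘ g) := g_cpt.comp_left rfl
  have hg₂ : ContDiff ℝ ∞ (Complex.ofRealCLM ∘ g) := by fun_prop
  -- Both transforms are tested against smooth compactly supported functions: the `L²` transform
  -- moves onto the test function by distributional duality, the integral by the multiplication
  -- formula `e3`.
  have e1 : ((𝓕 (h2.toLp f) : Lp ℂ 2 (volume : Measure ℝ)) : 𝓢'(ℝ, ℂ))
      (hg₁.toSchwartzMap hg₂) = ((h2.toLp f : Lp ℂ 2 (volume : Measure ℝ)) : 𝓢'(ℝ, ℂ))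
        (𝓕 (hg₁.toSchwartzMap hg₂)) := by
    rw [← Lp.fourier_toTemperedDistribution_eq, TemperedDistribution.fourier_apply]
  rw [Lp.toTemperedDistribution_apply, Lp.toTemperedDistribution_apply] at e1
  have e2 : ∫ t, (𝓕 (hg₁.toSchwartzMap hg₂)) t • (h2.toLp f) t
      = ∫ t, (𝓕 (hg₁.toSchwartzMap hg₂)) t • f t := by
    apply integral_congr_ae
    filter_upwards [h2.coeFn_toLp] with t ht
    rw [ht]
  have e3 : ∫ t, (𝓕 (hg₁.toSchwartzMap hg₂)) t • f t
      = ∫ t, (hg₁.toSchwartzMap hg₂) t • 𝓕 f t := by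
    have := VectorFourier.integral_fourierIntegral_smul_eq_flip (L := innerₗ ℝ)
      (μ := volume) (ν := volume) Real.continuous_fourierChar continuous_inner
      (hg₁.toSchwartzMap hg₂).integrable h1
    rw [flip_innerₗ] at this
    exact this
  rw [e2, e3] at e1
  simpa using e1.symm

theorem norm_sq_Lp_two {α : Type*} [MeasurableSpace α] {μ : Measure α} (f : Lp ℂ 2 μ) :
    ‖f‖ ^ 2 = ∫ a, ‖f a‖ ^ 2 ∂μ := by
  have h := congrArg Complex.re (inner_self_eq_norm_sq_to_K (𝕜 := ℂ) f)
  rw [L2.inner_def] at h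
  have e : ∀ a, inner ℂ (f a) (f a) = ((‖f a‖ ^ 2 : ℝ) : ℂ) := fun a => by
    rw [inner_self_eq_norm_sq_to_K]; norm_cast
  simp_rw [e] at h
  rw [integral_complex_ofReal] at h
  norm_cast at h
  exact h.symm

theorem norm_sq_toLp_two {α : Type*} [MeasurableSpace α] {μ : Measure α} {f : α → ℂ}
    (hf : MemLp f 2 μ) : ‖hf.toLp f‖ ^ 2 = ∫ a, ‖f a‖ ^ 2 ∂μ := by
  rw [norm_sq_Lp_two]
  exact integral_congr_ae (hf.coeFn_toLp.mono fun a ha => by simp only [ha])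

open FourierTransform in
theorem integral_norm_sq_fourier {f : ℝ → ℂ} (h1 : Integrable f) (h2 : MemLp f 2) :
    ∫ t, ‖𝓕 f t‖ ^ 2 = ∫ t, ‖f t‖ ^ 2 := by
  rw [← norm_sq_toLp_two h2, ← Lp.norm_fourier_eq, norm_sq_Lp_two]
  exact integral_congr_ae ((fourier_ae_eq_fourier_toLp h1 h2).mono fun a ha => by simp only [ha])

open FourierTransform in
/-- Plancherel's identity in the normalization `(2π)^{-1/2} ∫ f(u) e^{± i t u} du`. -/
theorem integral_norm_sq_scaled_fourier {f : ℝ → ℂ} (h1 : Integrable f) (h2 : MemLp f 2) {c : ℝ}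
    (hc : |c| = (2 * Real.pi)⁻¹) :
    ∫ t, ‖((1 / √(2 * Real.pi) : ℝ) : ℂ) * 𝓕 f (c * t)‖ ^ 2 = ∫ t, ‖f t‖ ^ 2 := by
  have hp : 0 < 2 * Real.pi := by positivity
  simp_rw [norm_mul, mul_pow]
  rw [integral_const_mul, Measure.integral_comp_mul_left (fun t => ‖𝓕 f t‖ ^ 2) c,
    integral_norm_sq_fourier h1 h2, abs_inv, hc, Complex.norm_real, Real.norm_eq_abs, sq_abs,
    div_pow, Real.sq_sqrt hp.le, smul_eq_mul]
  field_simp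

/-! ### Change of variables `ξ = e^{-u}` -/

theorem hasDerivWithinAt_exp_neg (u : ℝ) :
    HasDerivWithinAt (fun u : ℝ => Real.exp (-u)) (-Real.exp (-u)) univ u := by
  have h := ((Real.hasDerivAt_exp (-u)).comp u (hasDerivAt_neg u)).hasDerivWithinAt (s := univ)
  rwa [mul_neg_one] at h

theorem integrable_comp_exp_neg_iff {F : Type*} [NormedAddCommGroup F] [NormedSpace ℝ F]
    {g : ℝ → F} : (Integrable fun u : ℝ => Real.exp (-u) • g (Real.exp (-u))) ↔
      IntegrableOn g (Ioi 0) := by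
  rw [← exp_neg_image, integrableOn_image_iff_integrableOn_abs_deriv_smul MeasurableSet.univ
    (fun u _ => hasDerivWithinAt_exp_neg u) (fun a _ b _ h => by simpa using h)]
  simp [abs_of_pos (Real.exp_pos _)]

theorem integral_comp_exp_neg {F : Type*} [NormedAddCommGroup F] [NormedSpace ℝ F] (g : ℝ → F) :
    ∫ u : ℝ, Real.exp (-u) • g (Real.exp (-u)) = ∫ ξ in Ioi 0, g ξ := by
  rw [← exp_neg_image, integral_image_eq_integral_abs_deriv_smul MeasurableSet.univ
    (fun u _ => hasDerivWithinAt_exp_neg u) (fun a _ b _ h => by simpa using h)]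
  simp [abs_of_pos (Real.exp_pos _)]

/-- The weight `e^{-u/2}` is the square root of the Jacobian of `ξ = e^{-u}`, so the substitution
preserves the `L²` norm. -/
theorem norm_sq_exp_smul (x : ℝ → ℂ) (u : ℝ) :
    ‖Real.exp (-(1 / 2) * u) • x (Real.exp (-u))‖ ^ 2
      = Real.exp (-u) • ‖x (Real.exp (-u))‖ ^ 2 := by
  simp only [norm_smul, mul_pow, smul_eq_mul, Real.norm_eq_abs, Real.abs_exp]
  rw [← Real.exp_nat_mul]
  congr 2
  push_cast
  ring

theorem ofReal_exp_neg_cpow (u : ℝ) :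
    ((Real.exp (-u) : ℝ) : ℂ) ^ (-(1 / 2) : ℂ) = ((Real.exp (u / 2) : ℝ) : ℂ) := by
  rw [show (-(1 / 2) : ℂ) = ((-(1 / 2) : ℝ) : ℂ) by push_cast; ring,
    ← Complex.ofReal_cpow (Real.exp_pos _).le, ← Real.exp_mul]
  congr 2
  ring

theorem integrable_exp_smul_comp {x : L2Pos} (hx : x ∈ mellinDomain) :
    Integrable fun u : ℝ => Real.exp (-(1 / 2) * u) • x (Real.exp (-u)) := by
  refine (integrable_comp_exp_neg (integrableOn_mul_cpow hx 0)).congr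
    (Filter.Eventually.of_forall fun u => ?_)
  simp only [ofReal_exp_neg_cpow, Complex.ofReal_zero, mul_zero, Complex.cpow_zero, mul_one,
    Complex.real_smul]
  rw [mul_comm (x _), ← mul_assoc, ← Complex.ofReal_mul, ← Real.exp_add]
  congr 3
  ring

theorem memLp_exp_smul_comp {x : L2Pos} (hx : x ∈ mellinDomain) :
    MemLp (fun u : ℝ => Real.exp (-(1 / 2) * u) • x (Real.exp (-u))) 2 := by
  rw [memLp_two_iff_integrable_sq_norm (integrable_exp_smul_comp hx).aestronglyMeasurable]
  have h := (memLp_two_iff_integrable_sq_norm (Lp.aestronglyMeasurable x)).1 (Lp.memLp x)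
  simpa only [norm_sq_exp_smul] using integrable_comp_exp_neg h

/-! ### Norm bounds on the dense domains -/

theorem integral_norm_sq_mellinIntegral {x : L2Pos} (hx : x ∈ mellinDomain) :
    ∫ ν, ‖mellinIntegral x ν‖ ^ 2 = ‖x‖ ^ 2 := by
  simp_rw [mellinIntegral_eq]
  rw [integral_norm_sq_scaled_fourier (integrable_exp_smul_comp hx) (memLp_exp_smul_comp hx)
    (abs_of_pos (by positivity)), norm_sq_Lp_two, ← integral_comp_exp_neg]
  simp_rw [norm_sq_exp_smul]

theorem memLp_mellinIntegral_univ {x : L2Pos} (hx : x ∈ mellinDomain) :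
    MemLp (mellinIntegral x) 2 := by
  rw [show mellinIntegral x = _ from funext (mellinIntegral_eq x)]
  exact (memLp_comp_mul (memLp_fourier (integrable_exp_smul_comp hx) (memLp_exp_smul_comp hx))
    (by simp [Real.pi_ne_zero])).const_mul _

/-- The two components carry the halves `ν > 0` and `ν < 0` of the critical line, and their squared
norms add up to the Plancherel integral over the whole line. -/
theorem norm_mellinOnDomain (x : mellinDomain) : ‖mellinOnDomain x‖ = ‖x‖ := by
  rw [← sq_eq_sq₀ (norm_nonneg _) (norm_nonneg _), WithLp.prod_norm_sq_eq_of_L2]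
  change ‖(memLp_mellinIntegral x.2 one_ne_zero).toLp‖ ^ 2
    + ‖(memLp_mellinIntegral x.2 (neg_ne_zero.2 one_ne_zero)).toLp‖ ^ 2 = ‖x.1‖ ^ 2
  rw [norm_sq_toLp_two, norm_sq_toLp_two, ← integral_norm_sq_mellinIntegral x.2]
  simp only [one_mul, neg_one_mul]
  have hi : Integrable fun ν => ‖mellinIntegral x.1 ν‖ ^ 2 :=
    (memLp_two_iff_integrable_sq_norm (memLp_mellinIntegral_univ x.2).aestronglyMeasurable).1
      (memLp_mellinIntegral_univ x.2)
  rw [integral_comp_neg_Ioi 0 fun ν => ‖mellinIntegral x.1 ν‖ ^ 2, neg_zero, add_comm]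
  exact intervalIntegral.integral_Iic_add_Ioi hi.integrableOn hi.integrableOn

/-- Extension by zero is isometric, the full Fourier transform is isometric by Plancherel, and
restricting to `ℝ⁺` can only lose norm. -/
theorem norm_fourierOnDomain_le (x : fourierDomain) : ‖fourierOnDomain x‖ ≤ 1 * ‖x‖ := by
  rw [one_mul, ← sq_le_sq₀ (norm_nonneg _) (norm_nonneg _)]
  change ‖(memLp_fourierIntegralPos x.2 (Lp.memLp x.1)).toLp‖ ^ 2 ≤ ‖x.1‖ ^ 2
  have h1 : Integrable ((Ioi (0 : ℝ)).indicator x.1) :=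
    (integrable_indicator_iff measurableSet_Ioi).2 x.2
  have h2 : MemLp ((Ioi (0 : ℝ)).indicator x.1) 2 :=
    (memLp_indicator_iff_restrict measurableSet_Ioi).2 (Lp.memLp x.1)
  have hc : |(-(2 * Real.pi)⁻¹)| = (2 * Real.pi)⁻¹ := by
    rw [abs_neg, abs_of_pos (by positivity)]
  have e : ∫ t, ‖(Ioi (0 : ℝ)).indicator x.1 t‖ ^ 2 = ‖x.1‖ ^ 2 := by
    rw [norm_sq_Lp_two, ← integral_indicator measurableSet_Ioi]
    congr 1
    ext t
    by_cases ht : t ∈ Ioi (0 : ℝ)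
    · simp [indicator_of_mem ht]
    · simp [indicator_of_notMem ht]
  have hm : MemLp (fourierIntegralPos x.1) 2 := by
    rw [show fourierIntegralPos x.1 = _ from funext (fourierIntegralPos_eq x.1)]
    exact (memLp_comp_mul (memLp_fourier h1 h2) (by simp [Real.pi_ne_zero])).const_mul _
  rw [norm_sq_toLp_two, ← e, ← integral_norm_sq_scaled_fourier h1 h2 hc]
  simp_rw [← fourierIntegralPos_eq]
  exact setIntegral_le_integral
    ((memLp_two_iff_integrable_sq_norm hm.aestronglyMeasurable).1 hm)
    (Filter.Eventually.of_forall fun t => by positivity)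

/-! ### Test functions on the half-line -/

open ContDiff in
/-- The classes in `L²(ℝ⁺)` of smooth functions with compact support in `ℝ⁺`. -/
def testFunctions : Set L2Pos :=
  {x | ∃ g : ℝ → ℂ, ContDiff ℝ ∞ g ∧ HasCompactSupport g ∧ tsupport g ⊆ Ioi 0 ∧
    x =ᵐ[volume.restrict (Ioi 0)] g}

theorem integrable_mul_of_tsupport_subset {g : ℝ → ℂ} (hg : Continuous g)
    (hs : HasCompactSupport g) (ht : tsupport g ⊆ Ioi 0) {h : ℝ → ℂ}
    (hh : ContinuousOn h (Ioi 0)) : Integrable (fun ξ => g ξ * h ξ) := by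
  rw [← integrableOn_iff_integrable_of_support_subset (s := tsupport g)]
  · exact (hg.continuousOn.mul (hh.mono ht)).integrableOn_compact hs
  · exact fun ξ hξ => subset_tsupport g (left_ne_zero_of_mul hξ)

open ContDiff in
-- A vector orthogonal to all test functions integrates to zero against each of them, hence vanishes
-- almost everywhere. Real-valued test functions suffice, so the conjugation in the inner product
-- plays no role.
theorem dense_span_testFunctions : Dense (Submodule.span ℂ testFunctions : Set L2Pos) := by
  rw [Submodule.dense_iff_topologicalClosure_eq_top, Submodule.topologicalClosure_eq_top_iff,
    Submodule.eq_bot_iff]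
  intro y hy
  rw [Lp.eq_zero_iff_ae_eq_zero]
  have key := isOpen_Ioi.ae_eq_zero_of_integral_contDiff_smul_eq_zero (U := Ioi (0 : ℝ))
    (μ := volume.restrict (Ioi 0)) (f := y)
    (((Lp.memLp y).locallyIntegrable (by norm_num)).locallyIntegrableOn _) ?_
  · filter_upwards [key, ae_restrict_mem measurableSet_Ioi] with ξ h1 h2 using h1 h2
  intro g hg hc ht
  have hc' : HasCompactSupport (Complex.ofRealCLM ∘ g) := hc.comp_left rfl
  have hg' : ContDiff ℝ ∞ (Complex.ofRealCLM ∘ g) := by fun_prop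
  have hm : MemLp (Complex.ofRealCLM ∘ g) 2 (volume.restrict (Ioi (0 : ℝ))) :=
    hg'.continuous.memLp_of_hasCompactSupport hc'
  have hx : hm.toLp ∈ testFunctions :=
    ⟨_, hg', hc', (closure_mono fun ξ hξ => by simpa using hξ).trans ht, hm.coeFn_toLp⟩
  have h0 := (Submodule.mem_orthogonal _ _).1 hy _ (Submodule.subset_span hx)
  rw [L2.inner_def] at h0
  rw [← h0]
  apply integral_congr_ae
  filter_upwards [hm.coeFn_toLp] with ξ hξ
  rw [hξ]
  simp [mul_comm]

theorem testFunctions_subset_fourierDomain : testFunctions ⊆ (fourierDomain : Set L2Pos) := by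
  rintro x ⟨g, hg, hc, -, hx⟩
  exact (hg.continuous.integrable_of_hasCompactSupport hc).integrableOn.congr hx.symm

theorem mem_mellinDomain_iff_integrableOn {x : L2Pos} {g : ℝ → ℂ}
    (hx : x =ᵐ[volume.restrict (Ioi 0)] g) :
    x ∈ mellinDomain ↔
      IntegrableOn (fun ξ : ℝ => g ξ * (ξ : ℂ) ^ (-(1 / 2) : ℂ)) (Ioi 0) := by
  have hm : AEStronglyMeasurable (fun ξ : ℝ => g ξ * (ξ : ℂ) ^ (-(1 / 2) : ℂ))
      (volume.restrict (Ioi 0)) :=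
    ((Lp.aestronglyMeasurable x).congr hx).mul
      (by fun_prop : Measurable fun ξ : ℝ => (ξ : ℂ) ^ (-(1 / 2) : ℂ)).aestronglyMeasurable
  unfold IntegrableOn
  rw [← integrable_norm_iff hm]
  refine integrable_congr ?_
  filter_upwards [hx, ae_restrict_mem measurableSet_Ioi] with ξ h1 h2
  rw [h1, norm_mul, Complex.norm_cpow_eq_rpow_re_of_pos h2]
  simp

theorem continuousOn_ofReal_cpow (s : ℂ) : ContinuousOn (fun ξ : ℝ => (ξ : ℂ) ^ s) (Ioi 0) :=
  Complex.continuous_ofReal.continuousOn.cpow_const fun _ hξ => Or.inl hξ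

theorem testFunctions_subset_mellinDomain : testFunctions ⊆ (mellinDomain : Set L2Pos) := by
  rintro x ⟨g, hg, hc, ht, hx⟩
  exact (mem_mellinDomain_iff_integrableOn hx).2 (integrable_mul_of_tsupport_subset hg.continuous hc
    ht (continuousOn_ofReal_cpow _)).integrableOn

/-! ### Extension by continuity -/

theorem denseRange_subtype_of_testFunctions_subset {D : Submodule ℂ L2Pos}
    (h : testFunctions ⊆ (D : Set L2Pos)) : DenseRange D.subtype := by
  rw [DenseRange, Submodule.coe_subtype, Subtype.range_coe_subtype]
  exact dense_span_testFunctions.mono (Submodule.span_le.2 h)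

theorem truncatedFourier_apply (x : fourierDomain) : truncatedFourier x = fourierOnDomain x :=
  LinearMap.extendOfNorm_eq
    (denseRange_subtype_of_testFunctions_subset testFunctions_subset_fourierDomain)
    ⟨1, norm_fourierOnDomain_le⟩ x

theorem denseRange_mellinDomain_subtype : DenseRange mellinDomain.subtype :=
  denseRange_subtype_of_testFunctions_subset testFunctions_subset_mellinDomain

theorem mellinU_apply (x : mellinDomain) : mellinU x = mellinOnDomain x :=
  LinearMap.extendOfNorm_eq denseRange_mellinDomain_subtype
    ⟨1, fun x => by rw [one_mul]; exact (norm_mellinOnDomain x).le⟩ x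

theorem norm_mellinU (x : L2Pos) : ‖mellinU x‖ = ‖x‖ := by
  refine denseRange_mellinDomain_subtype.induction_on
    (p := fun x : L2Pos => ‖mellinU x‖ = ‖x‖) x ?_ fun x => ?_
  · exact isClosed_eq (by fun_prop) (by fun_prop)
  · exact (congrArg norm (mellinU_apply x)).trans (norm_mellinOnDomain x)

/-! ### Surjectivity of `mellinU` -/

theorem mellinIntegral_congr {x y : ℝ → ℂ} (h : x =ᵐ[volume.restrict (Ioi 0)] y) :
    mellinIntegral x = mellinIntegral y := by
  ext ν
  rw [mellinIntegral, mellinIntegral]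
  congr 1
  apply integral_congr_ae
  filter_upwards [h] with ξ hξ
  rw [hξ]

open FourierTransform SchwartzMap ContDiff in
/-- Every smooth compactly supported function on `ℝ` is a Mellin integral along the critical
line of a function of `𝒟`. -/
theorem exists_mellinIntegral_eq {f : ℝ → ℂ} (hf : ContDiff ℝ ∞ f) (hc : HasCompactSupport f) :
    ∃ x : mellinDomain, mellinIntegral x.1 = f := by
  have hp : 0 < 2 * Real.pi := by positivity
  have hs : 0 < √(2 * Real.pi) := Real.sqrt_pos.2 hp
  -- The factor `√(2π)` and the dilation by `2π` undo the normalization in `mellinIntegral_eq`.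
  have hc' : HasCompactSupport fun w => (√(2 * Real.pi) : ℂ) * f (2 * Real.pi * w) :=
    (hc.comp_homeomorph (Homeomorph.mulLeft₀ (2 * Real.pi) hp.ne')).mul_left
  let G : 𝓢(ℝ, ℂ) := hc'.toSchwartzMap (by fun_prop)
  let v : 𝓢(ℝ, ℂ) := 𝓕⁻ G
  have hv : 𝓕 (v : ℝ → ℂ) = G := by
    rw [← SchwartzMap.fourier_coe, FourierTransform.fourier_fourierInv_eq]
  -- Inverse of the substitution `x ↦ e^{-u/2} x(e^{-u})`, applied to `v`.
  let h : ℝ → ℂ := fun ξ => (ξ ^ (-(1 / 2) : ℝ)) • v (-Real.log ξ)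
  have hh : ∀ u, h (Real.exp (-u)) = Real.exp (u / 2) • v u := fun u => by
    simp only [h, Real.log_exp, neg_neg, ← Real.exp_mul]
    congr 2
    ring
  have hhv : (fun u : ℝ => Real.exp (-(1 / 2) * u) • h (Real.exp (-u))) = v := by
    ext u
    rw [hh, smul_smul, ← Real.exp_add]
    ring_nf
    simp
  have hmeas : AEStronglyMeasurable h (volume.restrict (Ioi (0 : ℝ))) := by
    have : Measurable h := by
      have := v.continuous.measurable
      fun_prop
    exact this.aestronglyMeasurable
  have h2 : MemLp h 2 (volume.restrict (Ioi (0 : ℝ))) := by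
    rw [memLp_two_iff_integrable_sq_norm hmeas]
    refine integrable_comp_exp_neg_iff.1 ?_
    simp_rw [← norm_sq_exp_smul]
    have := (memLp_two_iff_integrable_sq_norm (v.memLp 2).aestronglyMeasurable).1 (v.memLp 2)
    simpa only [← hhv] using this
  have h1 : h2.toLp ∈ mellinDomain := by
    -- The Jacobian `e^{-u}`, the factor `e^{u/2}` in `h` and the Mellin weight `e^{u/2}` cancel,
    -- leaving the integrability of the Schwartz function `v`.
    refine (mem_mellinDomain_iff_integrableOn h2.coeFn_toLp).2 (integrable_comp_exp_neg_iff.1 ?_)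
    refine v.integrable.congr (Filter.Eventually.of_forall fun u => ?_)
    simp only [ofReal_exp_neg_cpow, hh, Complex.real_smul]
    rw [mul_right_comm, ← mul_assoc, ← Complex.ofReal_mul, ← Complex.ofReal_mul, ← Real.exp_add,
      ← Real.exp_add]
    ring_nf
    simp
  refine ⟨⟨_, h1⟩, ?_⟩
  rw [mellinIntegral_congr h2.coeFn_toLp]
  ext ν
  rw [mellinIntegral_eq, hhv, hv]
  change ((1 / √(2 * Real.pi) : ℝ) : ℂ) *
    ((√(2 * Real.pi) : ℂ) * f (2 * Real.pi * ((2 * Real.pi)⁻¹ * ν))) = f ν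
  rw [mul_inv_cancel_left₀ hp.ne', ← mul_assoc, ← Complex.ofReal_mul, one_div_mul_cancel hs.ne']
  simp

theorem mellinBranch_eq_of_ae {c : ℝ} (hc : c ≠ 0) (x : mellinDomain) {y : L2Pos}
    (h : y =ᵐ[volume.restrict (Ioi 0)] fun μ => mellinIntegral x.1 (c * μ)) :
    mellinBranch c hc x = y :=
  Lp.ext ((memLp_mellinIntegral x.2 hc).coeFn_toLp.trans h.symm)

/-- The range of an isometry on a complete space is closed, so it is enough to reach a dense set in
each summand. A test function placed on one half of the critical line is a Mellin integral that
vanishes on the other half. -/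
theorem mellinU_surjective : Function.Surjective mellinU := by
  let V : L2Pos →ₗᵢ[ℂ] ModelSpace := ⟨mellinU.toLinearMap, norm_mellinU⟩
  let R : Submodule ℂ ModelSpace := LinearMap.range V.toLinearMap
  have hR : IsClosed (R : Set ModelSpace) := by
    have h : (R : Set ModelSpace) = range V := LinearMap.coe_range _
    rw [h]
    exact V.isometry.isClosedEmbedding.isClosed_range
  have hmem : ∀ x : mellinDomain,
      WithLp.toLp 2 (mellinBranch 1 one_ne_zero x,
        mellinBranch (-1) (neg_ne_zero.2 one_ne_zero) x) ∈ R :=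
    fun x => ⟨x, mellinU_apply x⟩
  have dense_of {T : L2Pos →L[ℂ] ModelSpace} (hT : ∀ x ∈ testFunctions, T x ∈ R) (x : L2Pos) :
      T x ∈ R := by
    have h1 : Submodule.span ℂ testFunctions ≤ R.comap T.toLinearMap := Submodule.span_le.2 hT
    have h2 : IsClosed (T ⁻¹' R) := hR.preimage T.continuous
    exact closure_minimal (s := (Submodule.span ℂ testFunctions : Set L2Pos)) h1 h2
      (dense_span_testFunctions x)
  let e := (WithLp.prodContinuousLinearEquiv 2 ℂ L2Pos L2Pos).symm.toContinuousLinearMap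
  have hl : ∀ y, WithLp.toLp 2 (y, (0 : L2Pos)) ∈ R := by
    refine dense_of (T := e.comp (ContinuousLinearMap.inl ℂ L2Pos L2Pos)) ?_
    rintro y ⟨g, hg, hc, ht, hy⟩
    obtain ⟨x, hx⟩ := exists_mellinIntegral_eq hg hc
    have h := hmem x
    rw [mellinBranch_eq_of_ae (y := y) _ x (by simpa [hx] using hy),
      mellinBranch_eq_of_ae (y := 0) _ x] at h
    · exact h
    · rw [hx]
      filter_upwards [Lp.coeFn_zero ℂ 2 (volume.restrict (Ioi (0 : ℝ))),
        ae_restrict_mem measurableSet_Ioi] with μ h0 hμ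
      -- The support lies in `ℝ⁺`, so the second component, which samples `g` at `-μ`, is zero.
      have : -1 * μ ∉ tsupport g := fun hm => by
        have h1 : 0 < -1 * μ := ht hm
        have h2 : 0 < μ := hμ
        linarith
      rw [image_eq_zero_of_notMem_tsupport this]
      exact h0
  have hr : ∀ y, WithLp.toLp 2 ((0 : L2Pos), y) ∈ R := by
    refine dense_of (T := e.comp (ContinuousLinearMap.inr ℂ L2Pos L2Pos)) ?_
    rintro y ⟨g, hg, hc, ht, hy⟩
    obtain ⟨x, hx⟩ := exists_mellinIntegral_eq (f := fun ν => g (-ν))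
      (hg.comp contDiff_neg) (hc.comp_homeomorph (Homeomorph.neg ℝ))
    have h := hmem x
    rw [mellinBranch_eq_of_ae (c := -1) (y := y) _ x (by simpa [hx] using hy),
      mellinBranch_eq_of_ae (y := 0) _ x] at h
    · exact h
    · rw [hx]
      filter_upwards [Lp.coeFn_zero ℂ 2 (volume.restrict (Ioi (0 : ℝ))),
        ae_restrict_mem measurableSet_Ioi] with μ h0 hμ
      have : -(1 * μ) ∉ tsupport g := fun hm => by
        have h1 : 0 < -(1 * μ) := ht hm
        have h2 : 0 < μ := hμ
        linarith
      rw [image_eq_zero_of_notMem_tsupport this]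
      exact h0
  intro φ
  have h := R.add_mem (hl φ.fst) (hr φ.snd)
  rw [← WithLp.toLp_add, Prod.mk_add_mk, add_zero, zero_add] at h
  exact h

/-- The operator `U` as a unitary operator. -/
def mellinUnitary : L2Pos ≃ₗᵢ[ℂ] ModelSpace :=
  LinearIsometryEquiv.ofSurjective ⟨mellinU.toLinearMap, norm_mellinU⟩ mellinU_surjective

theorem mellinUnitary_apply (x : L2Pos) : mellinUnitary x = mellinU x := rfl

open Filter Topology

/-! ### The Gamma integral with a complex rate -/

theorem norm_cpow_mul_exp_neg {a r : ℂ} {t : ℝ} (ht : 0 < t) :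
    ‖(t : ℂ) ^ (a - 1) * Complex.exp (-(r * t))‖ = t ^ (a.re - 1) * Real.exp (-r.re * t) := by
  rw [norm_mul, Complex.norm_cpow_eq_rpow_re_of_pos ht, Complex.norm_exp]
  simp

theorem measurable_cpow_mul_exp_neg (a r : ℂ) :
    Measurable fun t : ℝ => (t : ℂ) ^ (a - 1) * Complex.exp (-(r * t)) := by fun_prop

theorem integrableOn_rpow_mul_exp_neg_mul {s b : ℝ} (hs : -1 < s) (hb : 0 < b) :
    IntegrableOn (fun t : ℝ => t ^ s * Real.exp (-b * t)) (Ioi 0) := by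
  simpa using integrableOn_rpow_mul_exp_neg_mul_rpow hs one_pos hb

theorem integrableOn_cpow_mul_exp_neg {a r : ℂ} (ha : 0 < a.re) (hr : 0 < r.re) :
    IntegrableOn (fun t : ℝ => (t : ℂ) ^ (a - 1) * Complex.exp (-(r * t))) (Ioi 0) := by
  refine (integrableOn_rpow_mul_exp_neg_mul (s := a.re - 1) (by linarith) hr).mono'
    (measurable_cpow_mul_exp_neg a r).aestronglyMeasurable ?_
  filter_upwards [ae_restrict_mem measurableSet_Ioi] with t ht
  exact (norm_cpow_mul_exp_neg ht).le

/-- Differentiation under the integral sign: on the half-plane `Re z > Re r / 2` the derivative of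
the integrand is dominated by `t^{Re a} e^{-(Re r / 2) t}`. -/
theorem differentiableAt_integral_cpow_mul_exp_neg {a r : ℂ} (ha : 0 < a.re) (hr : 0 < r.re) :
    DifferentiableAt ℂ
      (fun r : ℂ => ∫ t : ℝ in Ioi 0, (t : ℂ) ^ (a - 1) * Complex.exp (-(r * t))) r := by
  have hs : {z : ℂ | r.re / 2 < z.re} ∈ 𝓝 r :=
    (isOpen_lt continuous_const Complex.continuous_re).mem_nhds (by simpa using hr)
  refine (hasDerivAt_integral_of_dominated_loc_of_deriv_le
    (F' := fun z t => (t : ℂ) ^ (a - 1) * (Complex.exp (-(z * t)) * -(t : ℂ)))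
    (bound := fun t => t ^ a.re * Real.exp (-(r.re / 2) * t)) hs
    (Eventually.of_forall fun z => (measurable_cpow_mul_exp_neg a z).aestronglyMeasurable)
    (integrableOn_cpow_mul_exp_neg ha hr) ?_ ?_
    (integrableOn_rpow_mul_exp_neg_mul (by linarith) (by linarith)) ?_).2.differentiableAt
  · exact Measurable.aestronglyMeasurable (by fun_prop)
  · filter_upwards [ae_restrict_mem measurableSet_Ioi] with t ht z hz
    have ht' : 0 < t := ht
    have hz' : r.re / 2 < z.re := hz
    rw [← mul_assoc, norm_mul, norm_cpow_mul_exp_neg ht, norm_neg, Complex.norm_real,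
      Real.norm_of_nonneg ht'.le, mul_right_comm, ← Real.rpow_add_one ht'.ne', sub_add_cancel]
    gcongr
  · refine Eventually.of_forall fun t z _ => ?_
    have h : HasDerivAt (fun z : ℂ => -(z * t)) (-(t : ℂ)) z := by
      simpa using! ((hasDerivAt_id z).mul_const (t : ℂ)).neg
    exact h.cexp.const_mul _

/-- The Gamma integral `∫ t^{a-1} e^{-rt} dt = r^{-a} Γ(a)` for complex `r`, `Re r > 0`. -/
theorem integral_cpow_mul_exp_neg_mul {a r : ℂ} (ha : 0 < a.re) (hr : 0 < r.re) :
    ∫ t : ℝ in Ioi 0, (t : ℂ) ^ (a - 1) * Complex.exp (-(r * t)) = (1 / r) ^ a * Complex.Gamma a := by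
  have hU : IsOpen {z : ℂ | 0 < z.re} := isOpen_lt continuous_const Complex.continuous_re
  have hf : AnalyticOnNhd ℂ
      (fun r : ℂ => ∫ t : ℝ in Ioi 0, (t : ℂ) ^ (a - 1) * Complex.exp (-(r * t)))
      {z : ℂ | 0 < z.re} := DifferentiableOn.analyticOnNhd
    (fun z hz => (differentiableAt_integral_cpow_mul_exp_neg ha hz).differentiableWithinAt) hU
  have hg : AnalyticOnNhd ℂ (fun r : ℂ => (1 / r) ^ a * Complex.Gamma a) {z : ℂ | 0 < z.re} := by
    refine DifferentiableOn.analyticOnNhd (fun z hz => ?_) hU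
    have hz' : 0 < z.re := hz
    have hz0 : z ≠ 0 := fun h => by simp [h] at hz'
    have h1 : 1 / z ∈ Complex.slitPlane := by
      left
      rw [one_div, Complex.inv_re]
      exact div_pos hz' (Complex.normSq_pos.2 hz0)
    have h2 : DifferentiableAt ℂ (fun z : ℂ => 1 / z) z := by
      simpa using differentiableAt_inv hz0
    exact ((h2.cpow_const h1).mul_const _).differentiableWithinAt
  -- Identity theorem: both sides are analytic on the right half-plane and agree at the real points
  -- `1 + 1/(n+1)`, which accumulate at 1.
  refine hf.eqOn_of_preconnected_of_frequently_eq (z₀ := 1) hg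
    (convex_halfSpace_re_gt 0).isPreconnected (by simp) ?_ hr
  have hseq : Tendsto (fun n : ℕ => ((1 + 1 / ((n : ℝ) + 1) : ℝ) : ℂ)) atTop (𝓝[≠] 1) := by
    refine tendsto_nhdsWithin_iff.2 ⟨?_, Eventually.of_forall fun n => ?_⟩
    · have h := (tendsto_one_div_add_atTop_nhds_zero_nat (𝕜 := ℝ)).const_add 1
      rw [add_zero] at h
      exact (Complex.continuous_ofReal.tendsto 1).comp h
    · have : (0 : ℝ) < 1 / ((n : ℝ) + 1) := by positivity
      rw [mem_compl_iff, mem_singleton_iff, Complex.ofReal_eq_one]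
      linarith
  refine hseq.frequently (Frequently.of_forall fun n => ?_)
  exact Complex.integral_cpow_mul_exp_neg_mul_Ioi ha (by positivity)

/-! ### The Mellin integral of a Fourier integral -/

/-- Since `1/(-iξ) = i/ξ`, the principal logarithm is `-log ξ + iπ/2`. This is the source of the
phase and of the exponential factor in the symbol. -/
theorem one_div_ofReal_neg_I_mul_cpow {ξ : ℝ} (hξ : 0 < ξ) (s : ℂ) :
    (1 / (-(Complex.I * ξ))) ^ s = Complex.exp (Complex.I * Real.pi / 2 * s) * (ξ : ℂ) ^ (-s) := by
  have h : (1 / (-(Complex.I * ξ)) : ℂ) = ((ξ⁻¹ : ℝ) : ℂ) * Complex.I := by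
    have : (ξ : ℂ) ≠ 0 := by exact_mod_cast hξ.ne'
    have := Complex.I_ne_zero
    push_cast
    field_simp
    simp
  have hξ0 : (ξ : ℂ) ≠ 0 := by exact_mod_cast hξ.ne'
  have hξi : ((ξ⁻¹ : ℝ) : ℂ) ≠ 0 := by exact_mod_cast (inv_pos.2 hξ).ne'
  rw [h, Complex.cpow_def_of_ne_zero (mul_ne_zero hξi Complex.I_ne_zero),
    Complex.cpow_def_of_ne_zero hξ0, Complex.log_ofReal_mul (inv_pos.2 hξ) Complex.I_ne_zero,
    Complex.log_I, ← Complex.exp_add, ← Complex.ofReal_log hξ.le, Real.log_inv]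
  congr 1
  push_cast
  ring

/-- A majorant uniform in `ε`: `|ε - iξ| ≥ ξ` controls the modulus, and the argument contributes at
most `e^{π|ν|}`. -/
theorem norm_one_div_sub_I_mul_cpow_le {ε ξ : ℝ} (hξ : 0 < ξ) (ν : ℝ) :
    ‖(1 / ((ε : ℂ) - Complex.I * ξ)) ^ (1 / 2 + Complex.I * ν : ℂ)‖
      ≤ Real.exp (Real.pi * |ν|) * ξ ^ (-(1 / 2) : ℝ) := by
  set z : ℂ := (ε : ℂ) - Complex.I * ξ with hz
  have hzim : z.im = -ξ := by simp [hz]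
  have hnorm : ξ ≤ ‖z‖ := by
    have := Complex.abs_im_le_norm z
    rwa [hzim, abs_neg, abs_of_pos hξ] at this
  refine (Complex.norm_cpow_le _ _).trans ?_
  have hre : (1 / 2 + Complex.I * ν : ℂ).re = 1 / 2 := by simp
  have him : (1 / 2 + Complex.I * ν : ℂ).im = ν := by simp
  rw [hre, him, div_eq_mul_inv, ← Real.exp_neg, mul_comm]
  gcongr
  · refine (neg_le_abs _).trans ?_
    rw [abs_mul]
    gcongr
    exact Complex.abs_arg_le_pi _
  · rw [norm_div, norm_one, one_div, Real.rpow_neg hξ.le, Real.inv_rpow (norm_nonneg _)]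
    gcongr

theorem tendsto_integral_mul_one_div_cpow {g : ℝ → ℂ} (hg : Continuous g)
    (hgi : IntegrableOn (fun ξ : ℝ => g ξ * (ξ : ℂ) ^ (-(1 / 2) : ℂ)) (Ioi 0)) (ν : ℝ) :
    Tendsto (fun ε : ℝ => ∫ ξ : ℝ in Ioi 0,
        g ξ * (1 / ((ε : ℂ) - Complex.I * ξ)) ^ (1 / 2 + Complex.I * ν : ℂ)) (𝓝[>] 0)
      (𝓝 (∫ ξ : ℝ in Ioi 0, g ξ * (1 / (-(Complex.I * ξ))) ^ (1 / 2 + Complex.I * ν : ℂ))) := by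
  refine tendsto_integral_filter_of_dominated_convergence
    (fun ξ => Real.exp (Real.pi * |ν|) * ‖g ξ * (ξ : ℂ) ^ (-(1 / 2) : ℂ)‖)
    (Eventually.of_forall fun ε => ?_) (Eventually.of_forall fun ε => ?_)
    (hgi.norm.const_mul _) ?_
  · have := hg.measurable
    exact Measurable.aestronglyMeasurable (by fun_prop)
  · filter_upwards [ae_restrict_mem measurableSet_Ioi] with ξ hξ
    rw [norm_mul, norm_mul, Complex.norm_cpow_eq_rpow_re_of_pos hξ (-(1 / 2)), mul_left_comm]
    refine mul_le_mul_of_nonneg_left ((norm_one_div_sub_I_mul_cpow_le hξ ν).trans_eq ?_)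
      (norm_nonneg _)
    simp
  · filter_upwards [ae_restrict_mem measurableSet_Ioi] with ξ hξ
    have hξ' : 0 < ξ := hξ
    have h0 : -(Complex.I * ξ) ≠ 0 := by simp [hξ'.ne']
    have h1 : Tendsto (fun ε : ℝ => 1 / ((ε : ℂ) - Complex.I * ξ)) (𝓝[>] 0)
        (𝓝 (1 / (-(Complex.I * ξ)))) := by
      refine tendsto_const_nhds.div ?_ h0
      have : ContinuousAt (fun ε : ℝ => (ε : ℂ) - Complex.I * ξ) 0 := by fun_prop
      simpa using this.tendsto.mono_left nhdsWithin_le_nhds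
    -- The limit point `i/ξ` is off the branch cut, so the power is continuous there.
    have h2 : 1 / (-(Complex.I * ξ)) ∈ Complex.slitPlane := by
      right
      simp [Complex.inv_im, hξ'.ne']
    exact ((continuousAt_cpow_const h2).tendsto.comp h1).const_mul _

/-- The factor `e^{-εt}` makes the double integral absolutely convergent. Fubini then leaves an
inner Gamma integral with rate `ε - iξ`. -/
theorem integral_fourierIntegralPos_mul_cpow_mul_exp {g : ℝ → ℂ} (hg : IntegrableOn g (Ioi 0))
    {s : ℂ} (hs : 0 < s.re) {ε : ℝ} (hε : 0 < ε) :
    ∫ t : ℝ in Ioi 0, fourierIntegralPos g t * ((t : ℂ) ^ (s - 1) * Complex.exp (-(ε * t)))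
      = ((1 / √(2 * Real.pi) : ℝ) : ℂ) * Complex.Gamma s *
        ∫ ξ : ℝ in Ioi 0, g ξ * (1 / ((ε : ℂ) - Complex.I * ξ)) ^ s := by
  have hprod : Integrable (Function.uncurry fun (t ξ : ℝ) =>
      (((t : ℂ) ^ (s - 1) * Complex.exp (-(ε * t))) * g ξ) * Complex.exp (Complex.I * t * ξ))
      ((volume.restrict (Ioi 0)).prod (volume.restrict (Ioi 0))) := by
    refine Integrable.mul_bdd (c := 1)
      ((integrableOn_cpow_mul_exp_neg hs (by simpa using hε)).mul_prod hg) (by fun_prop)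
      (Eventually.of_forall fun p => ?_)
    rw [show Complex.I * p.1 * p.2 = ((p.1 * p.2 : ℝ) : ℂ) * Complex.I by push_cast; ring,
      Complex.norm_exp_ofReal_mul_I]
  calc ∫ t : ℝ in Ioi 0, fourierIntegralPos g t * ((t : ℂ) ^ (s - 1) * Complex.exp (-(ε * t)))
      = ((1 / √(2 * Real.pi) : ℝ) : ℂ) * ∫ t : ℝ in Ioi 0, ∫ ξ : ℝ in Ioi 0,
          (((t : ℂ) ^ (s - 1) * Complex.exp (-(ε * t))) * g ξ) *
            Complex.exp (Complex.I * t * ξ) := by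
        rw [← integral_const_mul]
        congr 1
        ext t
        simp_rw [fourierIntegralPos, mul_assoc _ (g _), integral_const_mul]
        ring
    _ = ((1 / √(2 * Real.pi) : ℝ) : ℂ) * ∫ ξ : ℝ in Ioi 0, ∫ t : ℝ in Ioi 0,
          (((t : ℂ) ^ (s - 1) * Complex.exp (-(ε * t))) * g ξ) *
            Complex.exp (Complex.I * t * ξ) := by
        rw [integral_integral_swap hprod]
    _ = _ := by
        rw [mul_assoc, ← integral_const_mul (Complex.Gamma s)]
        congr 2
        ext ξ
        have hre : 0 < ((ε : ℂ) - Complex.I * ξ).re := by simpa using hε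
        rw [mul_left_comm, mul_comm (Complex.Gamma s), ← integral_cpow_mul_exp_neg_mul hs hre,
          ← integral_const_mul]
        congr 1
        ext t
        rw [show -(((ε : ℂ) - Complex.I * ξ) * t) = -(ε * t) + Complex.I * t * ξ by ring,
          Complex.exp_add]
        ring

theorem cpow_neg_half_mul_cpow {ξ : ℝ} (hξ : 0 < ξ) (w : ℂ) :
    (ξ : ℂ) ^ (-(1 / 2) : ℂ) * (ξ : ℂ) ^ w = (ξ : ℂ) ^ (1 / 2 + w - 1) := by
  rw [← Complex.cpow_add _ _ (by exact_mod_cast hξ.ne')]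
  congr 1
  ring

/-- The Mellin integral turns the Fourier integral into multiplication by `F₊₋`, together with
reflection of the critical line. -/
theorem mellinIntegral_fourierIntegralPos {g : ℝ → ℂ} (hg : Continuous g)
    (hg1 : IntegrableOn g (Ioi 0))
    (hgi : IntegrableOn (fun ξ : ℝ => g ξ * (ξ : ℂ) ^ (-(1 / 2) : ℂ)) (Ioi 0))
    (hF : IntegrableOn (fun t : ℝ => fourierIntegralPos g t * (t : ℂ) ^ (-(1 / 2) : ℂ)) (Ioi 0))
    (ν : ℝ) :
    mellinIntegral (fourierIntegralPos g) ν = symbolPM ν * mellinIntegral g (-ν) := by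
  set s : ℂ := 1 / 2 + Complex.I * ν with hs
  have hsre : 0 < s.re := by simp [hs]
  -- The regularized integral is evaluated in two ways as `ε → 0+`: here directly, by dominated
  -- convergence from `hF`, and in `hlim'` after the interchange of integrals.
  have hlim : Tendsto (fun ε : ℝ => ∫ t : ℝ in Ioi 0,
      fourierIntegralPos g t * ((t : ℂ) ^ (s - 1) * Complex.exp (-(ε * t)))) (𝓝[>] 0)
      (𝓝 (∫ t : ℝ in Ioi 0,
        fourierIntegralPos g t * (t : ℂ) ^ (-(1 / 2) : ℂ) * (t : ℂ) ^ (Complex.I * ν))) := by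
    refine tendsto_integral_filter_of_dominated_convergence
      (fun t => ‖fourierIntegralPos g t * (t : ℂ) ^ (-(1 / 2) : ℂ)‖) ?_ ?_ hF.norm ?_
    · refine Eventually.of_forall fun ε => ?_
      have h1 : AEStronglyMeasurable (fun t : ℝ =>
          (fourierIntegralPos g t * (t : ℂ) ^ (-(1 / 2) : ℂ)) *
            ((t : ℂ) ^ (Complex.I * ν) * Complex.exp (-(ε * t)))) (volume.restrict (Ioi 0)) :=
        hF.aestronglyMeasurable.mul (Measurable.aestronglyMeasurable (by fun_prop))
      refine h1.congr ?_
      filter_upwards [ae_restrict_mem measurableSet_Ioi] with t ht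
      rw [hs, ← cpow_neg_half_mul_cpow ht]
      ring
    · filter_upwards [self_mem_nhdsWithin] with ε hε
      filter_upwards [ae_restrict_mem measurableSet_Ioi] with t ht
      have hε' : 0 < ε := hε
      have ht' : 0 < t := ht
      rw [norm_mul, norm_cpow_mul_exp_neg ht, norm_mul, Complex.norm_cpow_eq_rpow_re_of_pos ht]
      gcongr
      have e : s.re - 1 = (-(1 / 2) : ℂ).re := by simp [hs]; norm_num
      rw [e]
      refine mul_le_of_le_one_right (Real.rpow_nonneg ht'.le _) (Real.exp_le_one_iff.2 ?_)
      rw [Complex.ofReal_re, neg_mul]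
      exact neg_nonpos.2 (by positivity)
    · filter_upwards [ae_restrict_mem measurableSet_Ioi] with t ht
      rw [mul_assoc, cpow_neg_half_mul_cpow ht, ← hs]
      refine Tendsto.const_mul _ ?_
      have : ContinuousAt (fun ε : ℝ => (t : ℂ) ^ (s - 1) * Complex.exp (-(ε * t))) 0 := by
        fun_prop
      simpa using this.tendsto.mono_left nhdsWithin_le_nhds
  have hlim' : Tendsto (fun ε : ℝ => ∫ t : ℝ in Ioi 0,
      fourierIntegralPos g t * ((t : ℂ) ^ (s - 1) * Complex.exp (-(ε * t)))) (𝓝[>] 0)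
      (𝓝 (((1 / √(2 * Real.pi) : ℝ) : ℂ) * Complex.Gamma s *
        ∫ ξ : ℝ in Ioi 0, g ξ * (1 / (-(Complex.I * ξ))) ^ s)) := by
    refine ((tendsto_integral_mul_one_div_cpow hg hgi ν).const_mul _).congr' ?_
    filter_upwards [self_mem_nhdsWithin] with ε hε
    exact (integral_fourierIntegralPos_mul_cpow_mul_exp hg1 hsre hε).symm
  have hint : ∫ ξ : ℝ in Ioi 0, g ξ * (1 / (-(Complex.I * ξ))) ^ s
      = Complex.exp (Complex.I * Real.pi / 2 * s) * ∫ ξ : ℝ in Ioi 0,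
        g ξ * (ξ : ℂ) ^ (-(1 / 2) : ℂ) * (ξ : ℂ) ^ (Complex.I * (-ν : ℝ)) := by
    rw [← integral_const_mul]
    refine setIntegral_congr_fun measurableSet_Ioi fun ξ hξ => ?_
    rw [one_div_ofReal_neg_I_mul_cpow hξ, mul_assoc (g ξ), cpow_neg_half_mul_cpow hξ,
      show 1 / 2 + Complex.I * ((-ν : ℝ) : ℂ) - 1 = -s by rw [hs]; push_cast; ring]
    ring
  have hexp : Complex.exp (Complex.I * Real.pi / 2 * s)
      = Complex.exp (Complex.I * Real.pi / 4) * Real.exp (-(Real.pi / 2) * ν) := by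
    rw [Complex.ofReal_exp, ← Complex.exp_add]
    congr 1
    rw [hs]
    push_cast
    -- `(iπ/2)(1/2 + iν) = iπ/4 - πν/2`.
    linear_combination (Real.pi / 2 * ν : ℂ) * Complex.I_mul_I
  rw [mellinIntegral, tendsto_nhds_unique hlim hlim', hint, hexp, mellinIntegral, symbolPM]
  ring

/-- Both entries of `F` are one function on the whole critical line, so the bound, the continuity
and the intertwining identity are needed for `symbolPM` only. -/
theorem symbolMP_eq (μ : ℝ) : symbolMP μ = symbolPM (-μ) := by
  rw [symbolMP, symbolPM, neg_mul_neg, Complex.ofReal_neg, mul_neg, ← sub_eq_add_neg]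

/-! ### The Fourier integral of a test function is in `𝒟` -/

/-- On `(0, 1]` boundedness reduces to the integrability of `t^{-1/2}`; beyond 1 the weight is at
most 1. -/
theorem integrableOn_mul_cpow_of_bounded {f : ℝ → ℂ} (hf : IntegrableOn f (Ioi 0)) {C : ℝ}
    (hC : ∀ t, ‖f t‖ ≤ C) :
    IntegrableOn (fun t : ℝ => f t * (t : ℂ) ^ (-(1 / 2) : ℂ)) (Ioi 0) := by
  have hm : AEStronglyMeasurable (fun t : ℝ => f t * (t : ℂ) ^ (-(1 / 2) : ℂ))
      (volume.restrict (Ioi 0)) :=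
    hf.aestronglyMeasurable.mul (Measurable.aestronglyMeasurable (by fun_prop))
  have hsub : Ioi (1 : ℝ) ⊆ Ioi 0 := Ioi_subset_Ioi zero_le_one
  rw [← Ioc_union_Ioi_eq_Ioi (zero_le_one (α := ℝ))]
  refine IntegrableOn.union ?_ ?_
  · have h1 : IntegrableOn (fun t : ℝ => t ^ (-(1 / 2) : ℝ)) (Ioc 0 1) :=
      (intervalIntegrable_iff_integrableOn_Ioc_of_le zero_le_one).1
        (intervalIntegral.intervalIntegrable_rpow' (by norm_num))
    refine (h1.const_mul C).mono' (hm.mono_set Ioc_subset_Ioi_self) ?_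
    filter_upwards [ae_restrict_mem measurableSet_Ioc] with t ht
    rw [norm_mul, Complex.norm_cpow_eq_rpow_re_of_pos ht.1]
    exact (mul_le_mul_of_nonneg_right (hC t) (Real.rpow_nonneg ht.1.le _)).trans_eq (by simp)
  · refine (hf.mono_set hsub).norm.mono' (hm.mono_set hsub) ?_
    filter_upwards [ae_restrict_mem measurableSet_Ioi] with t ht
    have ht' : 1 < t := ht
    rw [norm_mul, Complex.norm_cpow_eq_rpow_re_of_pos (zero_lt_one.trans ht')]
    refine mul_le_of_le_one_right (norm_nonneg _) (Real.rpow_le_one_of_one_le_of_nonpos ht'.le ?_)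
    norm_num

open FourierTransform SchwartzMap ContDiff in
-- With support inside `ℝ⁺` the truncation is invisible, so the Fourier integral is a rescaled
-- Schwartz function, both bounded and integrable.
theorem integrableOn_fourierIntegralPos_mul_cpow {g : ℝ → ℂ} (hg : ContDiff ℝ ∞ g)
    (hc : HasCompactSupport g) (ht : tsupport g ⊆ Ioi 0) :
    IntegrableOn (fun t : ℝ => fourierIntegralPos g t * (t : ℂ) ^ (-(1 / 2) : ℂ)) (Ioi 0) := by
  let G : 𝓢(ℝ, ℂ) := 𝓕 (hc.toSchwartzMap hg)
  have hind : (Ioi (0 : ℝ)).indicator g = g :=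
    indicator_eq_self.2 ((subset_tsupport g).trans ht)
  have hG : ∀ t, fourierIntegralPos g t
      = ((1 / √(2 * Real.pi) : ℝ) : ℂ) * G (-(2 * Real.pi)⁻¹ * t) := fun t => by
    rw [fourierIntegralPos_eq, hind]
    simp only [G, SchwartzMap.fourier_coe]
    rfl
  refine integrableOn_mul_cpow_of_bounded (C := ‖((1 / √(2 * Real.pi) : ℝ) : ℂ)‖ *
    ‖G.toBoundedContinuousFunction‖) ?_ fun t => ?_
  · rw [show fourierIntegralPos g = _ from funext hG]
    exact ((G.integrable.comp_mul_left' (by simp [Real.pi_ne_zero])).const_mul _).integrableOn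
  · rw [hG, norm_mul]
    gcongr
    exact G.toBoundedContinuousFunction.norm_coe_le_norm _

/-! ### The multiplication operator -/

/-- On the critical line `1 - s` is the conjugate of `s`, so the reflection formula `Γ(s)Γ(1-s) = π
/ sin(πs)` computes `|Γ(s)|²`. -/
theorem norm_Gamma_half_add_sq (ν : ℝ) :
    ‖Complex.Gamma (1 / 2 + Complex.I * ν)‖ ^ 2 = Real.pi / Real.cosh (Real.pi * ν) := by
  have h := Complex.Gamma_mul_Gamma_one_sub (1 / 2 + Complex.I * ν)
  have e1 : (1 - (1 / 2 + Complex.I * ν) : ℂ)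
      = (starRingEnd ℂ) (1 / 2 + Complex.I * ν) := by
    rw [map_add, map_mul, Complex.conj_I, Complex.conj_ofReal, map_div₀, map_one,
      Complex.conj_ofNat]
    ring
  have e2 : Complex.sin (Real.pi * (1 / 2 + Complex.I * ν)) = Real.cosh (Real.pi * ν) := by
    rw [show (Real.pi * (1 / 2 + Complex.I * ν) : ℂ)
        = ((Real.pi * ν : ℝ) : ℂ) * Complex.I + Real.pi / 2 by push_cast; ring,
      Complex.sin_add_pi_div_two, Complex.cos_mul_I, Complex.ofReal_cosh]
  rw [e1, Complex.Gamma_conj, Complex.mul_conj, e2, Complex.normSq_eq_norm_sq] at h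
  exact_mod_cast h

/-- The exact value is `|F₊₋(ν)|² = e^{-πν} / (e^{πν} + e^{-πν})`. -/
theorem norm_symbolPM_le (ν : ℝ) : ‖symbolPM ν‖ ≤ 1 := by
  rw [← sq_le_one_iff₀ (norm_nonneg _), symbolPM]
  have hexp : ‖Complex.exp (Complex.I * Real.pi / 4)‖ = 1 := by
    rw [show Complex.I * Real.pi / 4 = ((Real.pi / 4 : ℝ) : ℂ) * Complex.I by push_cast; ring,
      Complex.norm_exp_ofReal_mul_I]
  rw [norm_mul, norm_mul, norm_mul, mul_pow, mul_pow, mul_pow, hexp, norm_Gamma_half_add_sq,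
    Complex.norm_real, Complex.norm_real, Real.norm_eq_abs, Real.norm_eq_abs, sq_abs, sq_abs,
    div_pow, Real.sq_sqrt (by positivity), ← Real.exp_nat_mul, Real.cosh_eq]
  have h1 := Real.exp_pos (Real.pi * ν)
  have h2 := Real.exp_pos (-(Real.pi * ν))
  have hp := Real.pi_pos
  rw [show ((2 : ℕ) : ℝ) * (-(Real.pi / 2) * ν) = -(Real.pi * ν) by push_cast; ring]
  field_simp
  linarith

theorem continuous_symbolPM : Continuous symbolPM := by
  have h : Continuous fun ν : ℝ => Complex.Gamma (1 / 2 + Complex.I * ν) := by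
    refine continuous_iff_continuousAt.2 fun ν => ?_
    refine ContinuousAt.comp (f := fun ν : ℝ => (1 / 2 + Complex.I * ν : ℂ))
      (Complex.continuousAt_Gamma _ fun m hm => ?_) (by fun_prop)
    have := congrArg Complex.re hm
    simp only [Complex.add_re, Complex.mul_re, Complex.I_re, Complex.I_im, Complex.ofReal_re,
      Complex.ofReal_im, Complex.neg_re, Complex.natCast_re] at this
    norm_num at this
    have hm0 : (0 : ℝ) ≤ m := m.cast_nonneg
    linarith
  unfold symbolPM
  fun_prop

theorem norm_symbolMP_le (μ : ℝ) : ‖symbolMP μ‖ ≤ 1 :=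
  symbolMP_eq μ ▸ norm_symbolPM_le (-μ)

theorem continuous_symbolMP : Continuous symbolMP := by
  rw [show symbolMP = _ from funext symbolMP_eq]
  exact continuous_symbolPM.comp continuous_neg

theorem memLp_mul_of_norm_le_one {m : ℝ → ℂ} (hm : Continuous m) (hb : ∀ t, ‖m t‖ ≤ 1)
    (x : L2Pos) : MemLp (fun t => m t * x t) 2 (volume.restrict (Ioi 0)) := by
  refine (Lp.memLp x).of_le (hm.aestronglyMeasurable.mul (Lp.aestronglyMeasurable x))
    (Filter.Eventually.of_forall fun t => ?_)
  rw [norm_mul]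
  exact mul_le_of_le_one_left (norm_nonneg _) (hb t)

/-- Multiplication by a continuous function bounded by `1`, as a bounded operator on `L²(ℝ⁺)`. -/
def mulOperator (m : ℝ → ℂ) (hm : Continuous m) (hb : ∀ t, ‖m t‖ ≤ 1) : L2Pos →L[ℂ] L2Pos :=
  LinearMap.mkContinuous
    { toFun := fun x => (memLp_mul_of_norm_le_one hm hb x).toLp
      map_add' := fun x y => by
        rw [← MemLp.toLp_add, MemLp.toLp_eq_toLp_iff]
        filter_upwards [Lp.coeFn_add x y] with t ht
        rw [ht, Pi.add_apply, Pi.add_apply, mul_add]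
      map_smul' := fun c x => by
        rw [RingHom.id_apply, ← MemLp.toLp_const_smul, MemLp.toLp_eq_toLp_iff]
        filter_upwards [Lp.coeFn_smul c x] with t ht
        rw [ht, Pi.smul_apply, Pi.smul_apply, smul_eq_mul, smul_eq_mul, mul_left_comm] }
    1 fun x => by
      rw [one_mul]
      refine Lp.norm_le_norm_of_ae_le ?_
      filter_upwards [(memLp_mul_of_norm_le_one hm hb x).coeFn_toLp] with t ht
      change ‖(memLp_mul_of_norm_le_one hm hb x).toLp _ t‖ ≤ _
      rw [ht, norm_mul]
      exact mul_le_of_le_one_left (norm_nonneg _) (hb t)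

theorem mulOperator_ae_eq {m : ℝ → ℂ} (hm : Continuous m) (hb : ∀ t, ‖m t‖ ≤ 1) (x : L2Pos) :
    mulOperator m hm hb x =ᵐ[volume.restrict (Ioi 0)] fun t => m t * x t :=
  (memLp_mul_of_norm_le_one hm hb x).coeFn_toLp

/-- The operator of multiplication by the matrix function `F` on the model space. -/
def symbolOperator : ModelSpace →L[ℂ] ModelSpace :=
  let e := WithLp.prodContinuousLinearEquiv 2 ℂ L2Pos L2Pos
  let mPM := mulOperator symbolPM continuous_symbolPM norm_symbolPM_le
  let mMP := mulOperator symbolMP continuous_symbolMP norm_symbolMP_le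
  e.symm.toContinuousLinearMap.comp
    (((mPM.comp (ContinuousLinearMap.snd ℂ L2Pos L2Pos)).prod
      (mMP.comp (ContinuousLinearMap.fst ℂ L2Pos L2Pos))).comp e.toContinuousLinearMap)

theorem symbolOperator_fst (φ : ModelSpace) : (symbolOperator φ).fst =
    mulOperator symbolPM continuous_symbolPM norm_symbolPM_le φ.snd := rfl

theorem symbolOperator_snd (φ : ModelSpace) : (symbolOperator φ).snd =
    mulOperator symbolMP continuous_symbolMP norm_symbolMP_le φ.fst := rfl

theorem isMultiplicationBy_symbolOperator : IsMultiplicationBy symbolMatrix symbolOperator := by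
  intro φ
  filter_upwards [mulOperator_ae_eq continuous_symbolPM norm_symbolPM_le φ.snd,
    mulOperator_ae_eq continuous_symbolMP norm_symbolMP_le φ.fst] with μ h1 h2
  rw [ModelSpace.column, symbolOperator_fst, symbolOperator_snd, h1, h2]
  ext i
  fin_cases i <;>
    simp [symbolMatrix, ModelSpace.column, Matrix.mulVec, dotProduct]

/-! ### The intertwining relation -/

/-- For a test function, both it and its Fourier integral lie in `𝒟`, so `U` acts on each by an
absolutely convergent integral. The identity `key` at `ν = μ` gives the first component, at `ν = -μ`
the second. -/
theorem mellinU_truncatedFourier_of_mem {x : L2Pos} (hx : x ∈ testFunctions) :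
    mellinU (truncatedFourier x) = symbolOperator (mellinU x) := by
  have hxf := testFunctions_subset_fourierDomain hx
  have hxm := testFunctions_subset_mellinDomain hx
  obtain ⟨g, hg, hc, ht, hxg⟩ := hx
  have hFx : fourierIntegralPos x = fourierIntegralPos g := by
    ext t
    rw [fourierIntegralPos, fourierIntegralPos]
    congr 1
    apply integral_congr_ae
    filter_upwards [hxg] with ξ hξ
    rw [hξ]
  have hTx : truncatedFourier x =ᵐ[volume.restrict (Ioi 0)] fourierIntegralPos g := by
    rw [truncatedFourier_apply ⟨x, hxf⟩, ← hFx]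
    exact MemLp.coeFn_toLp (memLp_fourierIntegralPos hxf (Lp.memLp x))
  have hF := integrableOn_fourierIntegralPos_mul_cpow hg hc ht
  have hTm : truncatedFourier x ∈ mellinDomain := (mem_mellinDomain_iff_integrableOn hTx).2 hF
  have key : ∀ ν, mellinIntegral (truncatedFourier x) ν = symbolPM ν * mellinIntegral x (-ν) :=
    fun ν => by
      rw [mellinIntegral_congr hTx, mellinIntegral_congr hxg]
      exact mellinIntegral_fourierIntegralPos hg.continuous
        (hg.continuous.integrable_of_hasCompactSupport hc).integrableOn
        ((mem_mellinDomain_iff_integrableOn hxg).1 hxm) hF ν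
  have hU : mellinU (truncatedFourier x) = mellinOnDomain ⟨_, hTm⟩ := mellinU_apply ⟨_, hTm⟩
  have hU' : mellinU x = mellinOnDomain ⟨x, hxm⟩ := mellinU_apply ⟨x, hxm⟩
  rw [hU, hU']
  have h1 : mellinBranch 1 one_ne_zero ⟨_, hTm⟩
      = (symbolOperator (mellinOnDomain ⟨x, hxm⟩)).fst := by
    refine mellinBranch_eq_of_ae _ _ ?_
    rw [symbolOperator_fst]
    filter_upwards [mulOperator_ae_eq continuous_symbolPM norm_symbolPM_le
      (mellinOnDomain ⟨x, hxm⟩).snd,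
      (memLp_mellinIntegral hxm (neg_ne_zero.2 one_ne_zero)).coeFn_toLp] with μ e1 e2
    rw [e1, one_mul, key, ← neg_one_mul μ, ← e2]
    rfl
  have h2 : mellinBranch (-1) (neg_ne_zero.2 one_ne_zero) ⟨_, hTm⟩
      = (symbolOperator (mellinOnDomain ⟨x, hxm⟩)).snd := by
    refine mellinBranch_eq_of_ae _ _ ?_
    rw [symbolOperator_snd]
    filter_upwards [mulOperator_ae_eq continuous_symbolMP norm_symbolMP_le (mellinOnDomain ⟨x, hxm⟩).fst,
      (memLp_mellinIntegral hxm one_ne_zero).coeFn_toLp] with μ e1 e2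
    rw [one_mul] at e2
    rw [e1, neg_one_mul, key, neg_neg, symbolMP_eq, ← e2]
    rfl
  exact congrArg (WithLp.toLp 2) (Prod.ext h1 h2)

theorem mellinU_truncatedFourier (x : L2Pos) :
    mellinU (truncatedFourier x) = symbolOperator (mellinU x) :=
  DFunLike.congr_fun (ContinuousLinearMap.ext_on (f := mellinU.comp truncatedFourier)
    (g := symbolOperator.comp mellinU) dense_span_testFunctions
    fun _ hx => mellinU_truncatedFourier_of_mem hx) x

end TruncFourier

end

open MeasureTheory TruncFourier in
theorem theorem3p4 :
    ∃ (U : L2Pos ≃ₗᵢ[ℂ] ModelSpace) (MF : ModelSpace →L[ℂ] ModelSpace),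
      (∀ x, U x = mellinU x) ∧
      IsMultiplicationBy symbolMatrix MF ∧
      (∀ x : L2Pos, truncatedFourier x = U.symm (MF (U x))) ∧
      (∀ x : L2Pos, ∀ᵐ μ ∂(volume.restrict (Set.Ioi (0 : ℝ))),
        ModelSpace.column (U (truncatedFourier x)) μ =
          (symbolMatrix μ).mulVec (ModelSpace.column (U x) μ)) := by
  have h : ∀ x, mellinUnitary (truncatedFourier x) = symbolOperator (mellinUnitary x) :=
    mellinU_truncatedFourier
  refine ⟨mellinUnitary, symbolOperator, mellinUnitary_apply, isMultiplicationBy_symbolOperator,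
    fun x => ?_, fun x => ?_⟩
  · rw [← h, LinearIsometryEquiv.symm_apply_apply]
  · rw [h]
    exact isMultiplicationBy_symbolOperator _
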